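/- Let $X$ be a non-empty compact Hausdorff space, $T:X\to X$ a surjective local homeomorphism and $g:X\to\mathbf R_+^*$ a continuous function. Put $g_n(x)=g(x)g(Tx)\cdots g(T^{n-1}x)$ and let $$R(X,T)=\{(x,y)\in X\times X:\ T^nx=T^ny\ \text{for some } n\in\mathbf N\}=\bigcup_n R_n,\qquad R_n=\{(x,y):T^nx=T^ny\},$$ with the inductive limit topology of the $R_n\subset X\times X$ and the Haar system of counting measures $\lambda^x$ on the sets $\{(x,y): (x,y)\in R(X,T)\}$. Assume: 1. $R(X,T)$ is minimal, i.e. each of its equivalence classes is dense in $X$; 2. for some integer $L\ge1$ there is a $T^L$-cover $(\mathcal V,\mathcal U)$ which is a generator for $T^L$; 3. for some integer $M\ge1$ the function $g_M$ satisfies Walters' condition with respect to $T^M$. Then the stationary cocycle $D$ defined by $g$ on $R(X,T)$, i.e. $D(x,y)=g_n(x)/g_n(y)$ whenever $T^nx=T^ny$, is uniquely ergodic: there is exactly one Borel probability measure $\mu$ on $X$ which is quasi-invariant, i.e. the measure $\mu\circ\lambda=\int\lambda^x\,d\mu(x)$ on $R(X,T)$ and its image $(\mu\circ\lambda)^{-1}$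 under $(x,y)\mapsto(y,x)$ are equivalent, and which has $D$ as its Radon-Nikodym derivative $d(\mu\circ\lambda)/d(\mu\circ\lambda)^{-1}$. Here, for a map $S:X\to X$: * A (finite) $S$-cover $(\mathcal V,\mathcal U)$ consists of a finite open cover $\mathcal V$ of $X$ and, for each $V\in\mathcal V$, a finite partition of $S^{-1}(V)$ into open sets which $S$ maps homeomorphically onto $V$; $\mathcal U$ is the cover of $X$ by all these open sets. It is a generator for $S$ if one can choose for each $U\in\mathcal U$ a set $V(U)\in\mathcal V$ with $\overline U\subset V(U)$ in such a way that $\bigcap_n\bigcup_{W\in\mathcal U_n}W\times W$ is the diagonal of $X\times X$, where $\mathcal U_n$ is the family of the sets $U_1\cap S^{-1}(U_2)\cap\dots\cap S^{-(n-1)}(U_n)$ with $U_1,\dots,U_n\in\mathcal U$ and $S(U_k)=V(U_{k+1})$ for $1\le k<n$. * A continuous function $h:X\to\mathbf R_+^*$ satisfies Walters' condition with respect to $S$ if for every $\epsilon>0$ there is an entourage $\Delta$ of the uniform structure of $X$ such that the sets $\Delta_n=\{(x,y):(S^kx,S^ky)\in\Delta \text{ for } k=0,\dots,n-1\}$ decrease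 to the diagonal and, for all $n$, $$\sup_{(x,x')\in\Delta_n}\left|\frac{h(x)h(Sx)\cdots h(S^{n-1}x)}{h(x')h(Sx')\cdots h(S^{n-1}x')}-1\right|\le\epsilon .$$ -/

import Mathlib

open Set MeasureTheory Topology Uniformity
open scoped ENNReal

/-! ### The asymptotic equivalence relation `R(X,T)` as an étale groupoid -/

/-- The graph of `R(X,T) = {(x,y) : T^n x = T^n y for some n}`, as a type. -/
def AsympRel {X : Type*} (T : X → X) : Type _ :=
  {p : X × X // ∃ n : ℕ, T^[n] p.1 = T^[n] p.2}

namespace AsympRel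

variable {X : Type*} {T : X → X}

/-- The range map `r(x,y) = x`. -/
def r (γ : AsympRel T) : X := γ.1.1

/-- The source map `s(x,y) = y`. -/
def s (γ : AsympRel T) : X := γ.1.2

/-- The inversion `(x,y) ↦ (y,x)`. -/
def inv (γ : AsympRel T) : AsympRel T :=
  ⟨(γ.s, γ.r), γ.2.imp fun _ h => h.symm⟩

/-- The equivalence relation `R_n = {(x,y) : T^n x = T^n y}`, as a type. -/
abbrev Level (T : X → X) (n : ℕ) : Type _ :=
  {p : X × X // T^[n] p.1 = T^[n] p.2}

/-- The inclusion of `R_n` in `R(X,T)`. -/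
def ofLevel (n : ℕ) (p : Level T n) : AsympRel T := ⟨p.1, n, p.2⟩

/-- `R(X,T)` carries the inductive limit topology of the `R_n`, each of which has the topology
induced by `X × X`. -/
instance [TopologicalSpace X] : TopologicalSpace (AsympRel T) :=
  ⨆ n : ℕ, TopologicalSpace.coinduced (ofLevel n) inferInstance

instance [TopologicalSpace X] : MeasurableSpace (AsympRel T) := borel _

instance [TopologicalSpace X] : BorelSpace (AsympRel T) := ⟨rfl⟩

/-- The equivalence relation `R(X,T)` is minimal: every equivalence class is dense. -/
def IsMinimal [TopologicalSpace X] (T : X → X) : Prop :=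
  ∀ x : X, Dense {y : X | ∃ n : ℕ, T^[n] x = T^[n] y}

end AsympRel

/-! ### Cocycles and the Radon-Nikodym problem -/

/-- An element of `Z¹(R(X,T), ℝ₊*)`: a continuous strictly positive cocycle. -/
structure AsympCocycle {X : Type*} [TopologicalSpace X] (T : X → X) where
  toFun : AsympRel T → ℝ
  pos : ∀ γ, 0 < toFun γ
  continuous : Continuous toFun
  mul : ∀ γ η ζ : AsympRel T, γ.s = η.r → ζ.r = γ.r → ζ.s = η.s →
    toFun γ * toFun η = toFun ζ

section RadonNikodym

variable {X : Type*} [TopologicalSpace X] [MeasurableSpace X] (T : X → X)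

/-- The canonical Haar system: `λ^x` is the counting measure on the fibre `r⁻¹(x)`. -/
noncomputable def haarSystem (x : X) : Measure (AsympRel T) :=
  Measure.sum fun γ : {γ : AsympRel T // γ.r = x} => Measure.dirac γ.1

/-- The measure `μ ∘ λ = ∫ λ^x dμ(x)` on `R(X,T)`. -/
noncomputable def haarMeasure (μ : Measure X) : Measure (AsympRel T) :=
  μ.bind (haarSystem T)

/-- The measure `(μ ∘ λ)⁻¹`, the image of `μ ∘ λ` under the inversion. -/
noncomputable def haarMeasureInv (μ : Measure X) : Measure (AsympRel T) :=
  (haarMeasure T μ).map AsympRel.inv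

/-- `μ` is quasi-invariant: `μ ∘ λ` and `(μ ∘ λ)⁻¹` are equivalent. -/
def QuasiInvariant (μ : Measure X) : Prop :=
  haarMeasure T μ ≪ haarMeasureInv T μ ∧ haarMeasureInv T μ ≪ haarMeasure T μ

variable {T}

/-- The set `S_D(X)` of quasi-invariant probability measures which admit `D` as Radon-Nikodym
derivative of `μ ∘ λ` with respect to `(μ ∘ λ)⁻¹`. -/
def AsympCocycle.solutions (D : AsympCocycle T) : Set (ProbabilityMeasure X) :=
  {μ | QuasiInvariant T (μ : Measure X) ∧
    haarMeasure T (μ : Measure X) =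
      (haarMeasureInv T (μ : Measure X)).withDensity fun γ => ENNReal.ofReal (D.toFun γ)}

/-- `D` is uniquely ergodic: `S_D(X)` has exactly one element. -/
def AsympCocycle.UniquelyErgodic (D : AsympCocycle T) : Prop :=
  ∃ μ : ProbabilityMeasure X, D.solutions = {μ}

end RadonNikodym

/-! ### The stationary cocycle defined by a potential -/

/-- `g_n(x) = g(x) g(Tx) ⋯ g(T^{n-1}x)`. -/
def orbitProd {X : Type*} (T : X → X) (g : X → ℝ) (n : ℕ) (x : X) : ℝ :=
  ∏ k ∈ Finset.range n, g (T^[k] x)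

section Stationary

variable {X : Type*} {T : X → X} {g : X → ℝ}

theorem orbitProd_pos (hg : ∀ x, 0 < g x) (n : ℕ) (x : X) : 0 < orbitProd T g n x :=
  Finset.prod_pos fun _ _ => hg _

theorem orbitProd_div_eq (hg : ∀ x, 0 < g x) {m n : ℕ} (hmn : m ≤ n) {x y : X}
    (h : T^[m] x = T^[m] y) :
    orbitProd T g n x / orbitProd T g n y = orbitProd T g m x / orbitProd T g m y := by
  induction n, hmn using Nat.le_induction with
  | base => rfl
  | succ n hn ih =>
    have hxy : T^[n] x = T^[n] y := by
      obtain ⟨k, rfl⟩ := Nat.exists_eq_add_of_le' hn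
      rw [Function.iterate_add_apply, Function.iterate_add_apply, h]
    have e : ∀ z, orbitProd T g (n + 1) z = orbitProd T g n z * g (T^[n] z) :=
      fun z => Finset.prod_range_succ _ _
    rw [e, e, hxy, mul_div_mul_right _ _ (hg _).ne', ih]

open Classical in
/-- `D(x,y) = g_n(x) / g_n(y)` for (any, here the least) `n` with `T^n x = T^n y`. -/
noncomputable def stationaryFun (T : X → X) (g : X → ℝ) (γ : AsympRel T) : ℝ :=
  orbitProd T g (Nat.find γ.2) γ.r / orbitProd T g (Nat.find γ.2) γ.s

theorem stationaryFun_eq (hg : ∀ x, 0 < g x) (γ : AsympRel T) {n : ℕ}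
    (h : T^[n] γ.r = T^[n] γ.s) :
    stationaryFun T g γ = orbitProd T g n γ.r / orbitProd T g n γ.s := by
  classical
  exact (orbitProd_div_eq hg (Nat.find_min' γ.2 h) (Nat.find_spec γ.2)).symm

/-- The stationary cocycle on `R(X,T)` defined by `g`: its restriction to `R_n` has the
potential `g_n`. -/
noncomputable def stationaryCocycle [TopologicalSpace X] (T : X → X) (hT : Continuous T)
    (g : X → ℝ) (hgc : Continuous g) (hg : ∀ x, 0 < g x) : AsympCocycle T where
  toFun := stationaryFun T g
  pos γ := div_pos (orbitProd_pos hg _ _) (orbitProd_pos hg _ _)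
  continuous := by
    have hc : ∀ n, Continuous (orbitProd T g n) := fun n =>
      continuous_finsetProd _ fun k _ => hgc.comp (hT.iterate k)
    refine continuous_iSup_dom.2 fun n => continuous_coinduced_dom.2 ?_
    have e : stationaryFun T g ∘ AsympRel.ofLevel n =
        fun p : AsympRel.Level T n => orbitProd T g n p.1.1 / orbitProd T g n p.1.2 :=
      funext fun p => stationaryFun_eq hg (AsympRel.ofLevel n p) p.2
    rw [e]
    exact ((hc n).comp (continuous_fst.comp continuous_subtype_val)).div
      ((hc n).comp (continuous_snd.comp continuous_subtype_val))
      fun p => (orbitProd_pos hg _ _).ne'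
  mul γ η ζ h₁ h₂ h₃ := by
    obtain ⟨m, hm⟩ := γ.2
    obtain ⟨n, hn⟩ := η.2
    have a₁ : T^[n + m] γ.r = T^[n + m] γ.s := by
      rw [Function.iterate_add_apply, Function.iterate_add_apply]
      exact congrArg _ hm
    have a₂ : T^[n + m] η.r = T^[n + m] η.s := by
      rw [add_comm, Function.iterate_add_apply, Function.iterate_add_apply]
      exact congrArg _ hn
    have a₃ : T^[n + m] ζ.r = T^[n + m] ζ.s := by
      rw [h₂, h₃, a₁, h₁, a₂]
    rw [stationaryFun_eq hg γ a₁, stationaryFun_eq hg η a₂, stationaryFun_eq hg ζ a₃, h₂, h₃, h₁]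
    have := (orbitProd_pos (T := T) hg (n + m) η.r).ne'
    have := (orbitProd_pos (T := T) hg (n + m) η.s).ne'
    field_simp

end Stationary

/-! ### Covers, generators and Walters' condition -/

/-- A finite `π`-cover `(𝒱, 𝒰)`: `𝒱` is a finite open cover of `Y` and, for each `V ∈ 𝒱`, the
members of `𝒰` with image `V` form a partition of `π⁻¹(V)` into open sets which `π` maps
homeomorphically onto `V`; every member of `𝒰` is obtained in this way. -/
structure IsPiCover {X Y : Type*} [TopologicalSpace X] [TopologicalSpace Y] (π : X → Y)
    (𝒱 : Set (Set Y)) (𝒰 : Set (Set X)) : Prop where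
  finite_base : 𝒱.Finite
  finite_total : 𝒰.Finite
  isOpen_base : ∀ V ∈ 𝒱, IsOpen V
  cover : ⋃₀ 𝒱 = univ
  isOpen_total : ∀ U ∈ 𝒰, IsOpen U
  image_mem : ∀ U ∈ 𝒰, π '' U ∈ 𝒱
  homeo : ∀ U ∈ 𝒰, IsEmbedding (U.domRestrict π)
  disjoint : ∀ V ∈ 𝒱, {U ∈ 𝒰 | π '' U = V}.PairwiseDisjoint id
  union : ∀ V ∈ 𝒱, ⋃₀ {U ∈ 𝒰 | π '' U = V} = π ⁻¹' V

/-- The entourage `Δ_𝒰 = ⋃ U × U`. -/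
def coverEntourage {X : Type*} (𝒰 : Set (Set X)) : Set (X × X) :=
  ⋃ U ∈ 𝒰, U ×ˢ U

/-- The family `𝒰_n` of the sets `U_a = U_1 ∩ S⁻¹(U_2) ∩ ⋯ ∩ S^{-(n-1)}(U_n)`, where
`U_1, …, U_n ∈ 𝒰` and `S(U_k) = V(U_{k+1})`. Here `U_{k+1}` is `a k`. -/
def iteratedCover {X : Type*} (S : X → X) (𝒰 : Set (Set X)) (V : Set X → Set X) (n : ℕ) :
    Set (Set X) :=
  {W | ∃ a : ℕ → Set X, (∀ k < n, a k ∈ 𝒰) ∧ (∀ k, k + 1 < n → S '' a k = V (a (k + 1))) ∧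
    W = ⋂ k < n, S^[k] ⁻¹' a k}

/-- The `S`-cover `(𝒱, 𝒰)` is a generator: it defines a stationary tower, that is, each `U ∈ 𝒰`
has its closure inside a chosen `V(U) ∈ 𝒱`, and the entourages of the iterated covers `𝒰_n`
intersect in the diagonal. -/
def IsGeneratingCover {X : Type*} [TopologicalSpace X] (S : X → X) (𝒱 𝒰 : Set (Set X)) : Prop :=
  IsPiCover S 𝒱 𝒰 ∧ ∃ V : Set X → Set X, (∀ U ∈ 𝒰, V U ∈ 𝒱 ∧ closure U ⊆ V U) ∧
    (⋂ n : ℕ, coverEntourage (iteratedCover S 𝒰 V n)) = diagonal X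

/-- The multiplicative variation `sup_{(x,x') ∈ Δ} |g(x)/g(x') - 1|`. -/
noncomputable def mulVariation {X : Type*} (g : X → ℝ) (Δ : Set (X × X)) : ℝ≥0∞ :=
  ⨆ p ∈ Δ, ENNReal.ofReal |g p.1 / g p.2 - 1|

/-- The set `Δ_n = {(x,y) : (S^k x, S^k y) ∈ Δ for k = 0, …, n-1}`. -/
def dynEntourage {X : Type*} (S : X → X) (Δ : Set (X × X)) (n : ℕ) : Set (X × X) :=
  {p | ∀ k < n, (S^[k] p.1, S^[k] p.2) ∈ Δ}

/-- Walters' condition for the function `h` with respect to the map `S`. -/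
def WaltersCondition {X : Type*} [UniformSpace X] (S : X → X) (h : X → ℝ) : Prop :=
  ∀ ε : ℝ, 0 < ε → ∃ Δ ∈ 𝓤 X, (⋂ n : ℕ, dynEntourage S Δ n) = diagonal X ∧
    ∀ n : ℕ, mulVariation (orbitProd S h n) (dynEntourage S Δ n) ≤ ENNReal.ofReal ε

/-!
Let `𝓛` be the transfer operator with weight `g` and let `P_n f` be the conditional mean of `f` over
the `R_n`-classes, the point `y` having a weight proportional to `g_n(y)`. Two facts give the
theorem.

A probability measure `μ` solves the Radon-Nikodym problem for the stationary cocycle if and only if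
`∫ P_n f dμ = ∫ f dμ` for all `n` and all continuous `f` (`isMeanInvariant_of_solution`,
`solution_of_isMeanInvariant`). Restricted to `R_n`, the equation `μ ∘ λ = D · (μ ∘ λ)⁻¹` is an
identity between integrals of finite sums over classes, and within a class the weights of two points
have quotient `D`. Measurability of the Haar system is obtained from the continuous local sections
of the finite covering `T^n`.

Along the multiples of `M`, `P_n f` converges uniformly to a constant for each continuous `f`
(`exists_classMean_limit`). Hence an invariant measure is determined by these constants, and a limit
point of the measures `f ↦ (P_n f)(x₀)` is invariant. For the convergence, pass to `S = T^M` and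
`h = g_M`. Walters' condition for `ε = 1` provides an expansive entourage `Δ` such that the weights
`h_n` vary by at most a factor two on `Δ_n`. An expansive local homeomorphism contracts backwards:
there is `N` such that for `Δ_N`-close points `x, x'` and every `n`, the fibres `S^{-n}(x)` and
`S^{-n}(x')` are matched by points whose orbits stay close (`exists_fibre_matching`). So
`𝓛ⁿu(x) ≤ 2 𝓛ⁿ(u + η)(x')` for `u ≥ 0` and `n` large. Since by minimality all fibres of some `S^m`
are `Δ_N`-dense, this spreads over all of `X` and yields
`P_{n+m}u(z) ≥ c (P_n u(x) - η)` for all `x, z`, with `c > 0` independent of `n` and `u`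
(`exists_classMean_lower_bound`). Applied to `u = P_k f - a`, where `a` is a lower bound of `P_k f`
close to the supremum of all such bounds over all `k`, it forces `sup P_n f` down to that supremum.
-/

/-! ### Fibres of local homeomorphisms of a compact space -/

section LocalHomeomorph

variable {X : Type*}

open Classical in
/-- The fibre `π⁻¹(x)` as a finite set. It is empty by convention if `π⁻¹(x)` is infinite, which
does not happen for a local homeomorphism of a compact Hausdorff space. -/
noncomputable def fibre (π : X → X) (x : X) : Finset X :=
  if h : (π ⁻¹' {x}).Finite then h.toFinset else ∅

variable [TopologicalSpace X]

theorem IsLocalHomeomorph.iterate {T : X → X} (hT : IsLocalHomeomorph T) (n : ℕ) :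
    IsLocalHomeomorph T^[n] := by
  induction n with
  | zero => exact (Homeomorph.refl X).isLocalHomeomorph
  | succ n ih => exact ih.comp hT

variable [CompactSpace X] [T2Space X] {π : X → X}

theorem IsLocalHomeomorph.finite_preimage_singleton (hπ : IsLocalHomeomorph π) (x : X) :
    (π ⁻¹' {x}).Finite := by
  have h := (isLocalHomeomorph_iff_isCoveringMap.1 hπ x).1
  exact (isClosed_singleton.preimage hπ.continuous).isCompact.finite
    (isDiscrete_iff_discreteTopology.2 h)

theorem IsLocalHomeomorph.mem_fibre (hπ : IsLocalHomeomorph π) {x y : X} :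
    y ∈ fibre π x ↔ π y = x := by
  simp [fibre, hπ.finite_preimage_singleton x]

/-- Over a small neighbourhood `V` of any point, the fibres of `π` are enumerated by finitely many
continuous sections. -/
theorem IsLocalHomeomorph.exists_local_sections (hπ : IsLocalHomeomorph π) (x₀ : X) :
    ∃ V : Set X, IsOpen V ∧ x₀ ∈ V ∧ ∃ σ : π ⁻¹' {x₀} → X → X, (∀ i, ContinuousOn (σ i) V) ∧
      ∀ x ∈ V, (Function.Injective fun i => σ i x) ∧ ∀ y, π y = x ↔ ∃ i, σ i x = y := by
  classical
  obtain ⟨-, V, hxV, hV, -, H, hH⟩ := isLocalHomeomorph_iff_isCoveringMap.1 hπ x₀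
  have hS : ∀ (x : X) (hx : x ∈ V) (i), π (H.symm (⟨x, hx⟩, i)).1 = x := fun x hx i => by
    rw [← hH]; simp
  refine ⟨V, hV, hxV, fun i x => if hx : x ∈ V then (H.symm (⟨x, hx⟩, i)).1 else x, ?_, ?_⟩
  · intro i
    rw [continuousOn_iff_continuous_domRestrict]
    have : Continuous fun x : V => (H.symm (x, i)).1 := by fun_prop
    refine this.congr fun x => ?_
    simp
  · intro x hx
    refine ⟨fun i j hij => ?_, fun y => ⟨fun hy => ?_, ?_⟩⟩
    · simp only [hx, dif_pos] at hij
      have := H.symm.injective (Subtype.ext hij)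
      simpa using this
    · have hyV : y ∈ π ⁻¹' V := by rw [mem_preimage, hy]; exact hx
      refine ⟨(H ⟨y, hyV⟩).2, ?_⟩
      have : ((⟨x, hx⟩, (H ⟨y, hyV⟩).2) : V × _) = H ⟨y, hyV⟩ :=
        Prod.ext (Subtype.ext (by simp only [hH]; exact hy.symm)) rfl
      simp [hx, this]
    · rintro ⟨i, rfl⟩
      simpa [hx] using hS x hx i

theorem IsLocalHomeomorph.continuous_sum_fibre (hπ : IsLocalHomeomorph π) {φ : X → ℝ}
    (hφ : Continuous φ) : Continuous fun x => ∑ y ∈ fibre π x, φ y := by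
  classical
  refine continuous_iff_continuousAt.2 fun x₀ => ?_
  obtain ⟨V, hV, hx₀, σ, hσ, h⟩ := hπ.exists_local_sections x₀
  have : Fintype (π ⁻¹' {x₀}) := (hπ.finite_preimage_singleton x₀).fintype
  have h1 : ContinuousAt (fun x => ∑ i, φ (σ i x)) x₀ :=
    tendsto_finsetSum _ fun i _ =>
      hφ.continuousAt.comp ((hσ i).continuousAt (hV.mem_nhds hx₀))
  refine h1.congr ?_
  filter_upwards [hV.mem_nhds hx₀] with x hx
  have : fibre π x = Finset.univ.image fun i => σ i x := by
    ext y
    rw [hπ.mem_fibre, (h x hx).2]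
    simp
  rw [this, Finset.sum_image fun i _ j _ hij => (h x hx).1 hij]

end LocalHomeomorph

/-! ### Expansive local homeomorphisms -/

theorem dynEntourage_mono {X : Type*} {S : X → X} {Δ : Set (X × X)} {m n : ℕ} (h : m ≤ n) :
    dynEntourage S Δ n ⊆ dynEntourage S Δ m := fun _ hp k hk => hp k (hk.trans_le h)

theorem dynEntourage_mono_left {X : Type*} {S : X → X} {Δ Δ' : Set (X × X)} (h : Δ ⊆ Δ') (n : ℕ) :
    dynEntourage S Δ n ⊆ dynEntourage S Δ' n := fun _ hp k hk => h (hp k hk)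

section Entourages

variable {X : Type*} [UniformSpace X] [CompactSpace X] {S : X → X}

/-- In a compact space a local homeomorphism is uniformly open: points near `S y` lift to points
near `y`. -/
theorem IsLocalHomeomorph.exists_uniform_lift [T2Space X] (hS : IsLocalHomeomorph S)
    {E : Set (X × X)} (hE : E ∈ 𝓤 X) :
    ∃ δ ∈ 𝓤 X, ∀ y x', (S y, x') ∈ δ → ∃ y', S y' = x' ∧ (y, y') ∈ E := by
  have hO : IsOpen (Prod.map id S '' interior E) :=
    (IsOpenMap.id.prodMap hS.isOpenMap) _ isOpen_interior
  -- The pairs `(S y, x')` for which `x'` does not lift form a compact set off the diagonal.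
  have hK : IsCompact (Prod.map S id '' (Prod.map id S '' interior E)ᶜ) :=
    hO.isClosed_compl.isCompact.image (hS.continuous.prodMap continuous_id)
  refine ⟨(Prod.map S id '' (Prod.map id S '' interior E)ᶜ)ᶜ, ?_, fun y x' h => ?_⟩
  · rw [← nhdsSet_diagonal_eq_uniformity, hK.isClosed.isOpen_compl.mem_nhdsSet]
    rintro ⟨x, x'⟩ (rfl : x = x') ⟨⟨y, z⟩, hy, hyz⟩
    obtain ⟨h1, h2⟩ : S y = x ∧ z = x := by simpa using hyz
    refine hy ⟨(y, y), ?_, by simp [h1, h2]⟩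
    exact refl_mem_uniformity (interior_mem_uniformity hE)
  · by_contra hno
    refine h ⟨(y, x'), ?_, rfl⟩
    rintro ⟨⟨u, v⟩, huv, he⟩
    obtain ⟨h1, h2⟩ : u = y ∧ S v = x' := by simpa using he
    exact hno ⟨v, h2, h1 ▸ interior_subset huv⟩

theorem IsLocalHomeomorph.exists_uniform_injective (hS : IsLocalHomeomorph S) :
    ∃ E ∈ 𝓤 X, ∀ u v, (u, v) ∈ E → S u = S v → u = v := by
  choose U hU hxU hinj using hS.isLocallyInjective
  refine ⟨⋃ x, U x ×ˢ U x, ?_, ?_⟩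
  · rw [← nhdsSet_diagonal_eq_uniformity, IsOpen.mem_nhdsSet]
    · rintro ⟨x, y⟩ (rfl : x = y)
      exact mem_iUnion.2 ⟨x, hxU x, hxU x⟩
    · exact isOpen_iUnion fun x => (hU x).prod (hU x)
  · intro u v h huv
    obtain ⟨x, hu, hv⟩ := mem_iUnion.1 h
    exact hinj x hu hv huv

theorem dynEntourage_mem_uniformity (hS : Continuous S) {Δ : Set (X × X)} (hΔ : Δ ∈ 𝓤 X) (n : ℕ) :
    dynEntourage S Δ n ∈ 𝓤 X := by
  have : dynEntourage S Δ n = ⋂ k ∈ Finset.range n, {p | (S^[k] p.1, S^[k] p.2) ∈ Δ} := by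
    ext p; simp [dynEntourage]
  rw [this, Filter.biInter_finset_mem]
  exact fun k _ => CompactSpace.uniformContinuous_of_continuous (hS.iterate k) hΔ

theorem exists_dynEntourage_subset (hS : Continuous S) {Δ : Set (X × X)} (hc : IsClosed Δ)
    (hd : (⋂ n, dynEntourage S Δ n) ⊆ diagonal X) {E : Set (X × X)} (hE : E ∈ 𝓤 X) :
    ∃ N, dynEntourage S Δ N ⊆ E := by
  refine exists_subset_nhds_of_compactSpace
    (directed_of_isDirected_le fun m n h => dynEntourage_mono h) (fun n => ?_) fun p hp => ?_
  · have : dynEntourage S Δ n = ⋂ k, ⋂ _ : k < n, Prod.map S^[k] S^[k] ⁻¹' Δ := by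
      ext p; simp [dynEntourage, Prod.map]
    rw [this]
    exact isClosed_biInter fun k _ => hc.preimage ((hS.iterate k).prodMap (hS.iterate k))
  · obtain ⟨x, y⟩ := p
    obtain rfl : x = y := hd hp
    rw [← nhdsSet_diagonal_eq_uniformity] at hE
    exact nhds_le_nhdsSet (s := diagonal X) rfl hE

/-- A compact space with a continuous expansive map has a countably generated uniformity. -/
theorem isCountablyGenerated_uniformity_of_expansive (hS : Continuous S) {Δ : Set (X × X)}
    (hΔ : Δ ∈ 𝓤 X) (hd : (⋂ n, dynEntourage S Δ n) ⊆ diagonal X) :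
    (𝓤 X).IsCountablyGenerated := by
  obtain ⟨Δ', ⟨h1, h2⟩, h3⟩ := uniformity_hasBasis_closed.mem_iff.1 hΔ
  have hd' : (⋂ n, dynEntourage S Δ' n) ⊆ diagonal X :=
    (iInter_mono fun n => dynEntourage_mono_left h3 n).trans hd
  have : (𝓤 X).HasBasis (fun _ : ℕ => True) (dynEntourage S Δ') :=
    ⟨fun E => ⟨fun hE => (exists_dynEntourage_subset hS h2 hd' hE).imp fun _ h => ⟨trivial, h⟩,
      fun ⟨n, _, h⟩ => Filter.mem_of_superset (dynEntourage_mem_uniformity hS h1 n) h⟩⟩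
  exact this.isCountablyGenerated

end Entourages

/-! ### Transfer operators and conditional means -/

section Transfer

variable {X : Type*}

/-- The `n`-th power of the Ruelle transfer operator of `T` with weight `g`:
`(𝓛ⁿ f)(x) = ∑_{T^n y = x} g_n(y) f(y)`. -/
noncomputable def transfer (T : X → X) (g : X → ℝ) (n : ℕ) (f : X → ℝ) (x : X) : ℝ :=
  ∑ y ∈ fibre T^[n] x, orbitProd T g n y * f y

/-- The conditional mean `(P_n f)(x)`: the average of `f` over the `R_n`-class of `x`, in which
the point `y` has a weight proportional to `g_n(y)`. -/
noncomputable def classMean (T : X → X) (g : X → ℝ) (n : ℕ) (f : X → ℝ) (x : X) : ℝ :=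
  transfer T g n f (T^[n] x) / transfer T g n 1 (T^[n] x)

variable {T : X → X} {g : X → ℝ}

theorem orbitProd_add (m n : ℕ) (x : X) :
    orbitProd T g (m + n) x = orbitProd T g m x * orbitProd T g n (T^[m] x) := by
  simp only [orbitProd, Finset.prod_range_add]
  congr 1
  refine Finset.prod_congr rfl fun k _ => ?_
  rw [← Function.iterate_add_apply, add_comm]

/-- The weights of `T^M` with potential `g_M` are the weights of `T` with potential `g`. -/
theorem orbitProd_iterate (M n : ℕ) (x : X) :
    orbitProd T^[M] (orbitProd T g M) n x = orbitProd T g (M * n) x := by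
  induction n with
  | zero => simp [orbitProd]
  | succ n ih =>
    rw [Nat.mul_succ, orbitProd_add (T := T) (g := g), ← ih, Function.iterate_mul]
    exact Finset.prod_range_succ _ _

theorem classMean_iterate (M n : ℕ) (f : X → ℝ) :
    classMean T^[M] (orbitProd T g M) n f = classMean T g (M * n) f := by
  funext x
  simp only [classMean, transfer, orbitProd_iterate, Function.iterate_mul]

theorem transfer_add_fun (n : ℕ) (u v : X → ℝ) (x : X) :
    transfer T g n (u + v) x = transfer T g n u x + transfer T g n v x := by
  simp [transfer, mul_add, Finset.sum_add_distrib]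

theorem transfer_const (n : ℕ) (a : ℝ) (x : X) :
    transfer T g n (fun _ => a) x = a * transfer T g n 1 x := by
  simp [transfer, Finset.mul_sum, mul_comm]

theorem transfer_mono (hg : ∀ x, 0 < g x) (n : ℕ) {u v : X → ℝ} (h : ∀ x, u x ≤ v x) (x : X) :
    transfer T g n u x ≤ transfer T g n v x :=
  Finset.sum_le_sum fun y _ => mul_le_mul_of_nonneg_left (h y) (orbitProd_pos hg n y).le

theorem continuous_orbitProd [TopologicalSpace X] (hT : Continuous T) (hgc : Continuous g) (n : ℕ) :
    Continuous (orbitProd T g n) :=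
  continuous_finsetProd _ fun k _ => hgc.comp (hT.iterate k)

variable [TopologicalSpace X] [CompactSpace X] [T2Space X]

theorem continuous_transfer (hT : IsLocalHomeomorph T) (hgc : Continuous g) (n : ℕ) {f : X → ℝ}
    (hf : Continuous f) : Continuous (transfer T g n f) :=
  (hT.iterate n).continuous_sum_fibre ((continuous_orbitProd hT.continuous hgc n).mul hf)

theorem transfer_add (hT : IsLocalHomeomorph T) (m n : ℕ) (f : X → ℝ) (z : X) :
    transfer T g (n + m) f z = transfer T g m (transfer T g n f) z := by
  classical
  simp only [transfer, Finset.mul_sum]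
  rw [← Finset.sum_fiberwise_of_maps_to (s := fibre T^[n + m] z) (t := fibre T^[m] z) (g := T^[n])]
  · refine Finset.sum_congr rfl fun y hy => Finset.sum_congr ?_ fun u hu => ?_
    · ext u
      rw [(hT.iterate m).mem_fibre] at hy
      simp only [Finset.mem_filter, (hT.iterate _).mem_fibre, add_comm n m,
        Function.iterate_add_apply]
      exact ⟨fun h => h.2, fun h => ⟨by rw [h, hy], h⟩⟩
    · rw [(hT.iterate n).mem_fibre] at hu
      rw [orbitProd_add, hu]
      ring
  · intro u hu
    rw [(hT.iterate _).mem_fibre] at hu ⊢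
    rw [← hu, ← Function.iterate_add_apply, add_comm]

theorem transfer_one_pos (hT : IsLocalHomeomorph T) (hsurj : Function.Surjective T)
    (hg : ∀ x, 0 < g x) (n : ℕ) (x : X) : 0 < transfer T g n 1 x := by
  obtain ⟨y, hy⟩ := hsurj.iterate n x
  refine Finset.sum_pos (fun z _ => by simpa using orbitProd_pos hg n z) ⟨y, ?_⟩
  exact (hT.iterate n).mem_fibre.2 hy

theorem continuous_classMean (hT : IsLocalHomeomorph T) (hsurj : Function.Surjective T)
    (hgc : Continuous g) (hg : ∀ x, 0 < g x) (n : ℕ) {f : X → ℝ} (hf : Continuous f) :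
    Continuous (classMean T g n f) :=
  ((continuous_transfer hT hgc n hf).comp (hT.iterate n).continuous).div
    ((continuous_transfer hT hgc n continuous_one).comp (hT.iterate n).continuous)
    fun _ => (transfer_one_pos hT hsurj hg n _).ne'

/-- `P_n` does not change under conditioning on a smaller relation `R_m` first. -/
theorem classMean_classMean (hT : IsLocalHomeomorph T) (hsurj : Function.Surjective T)
    (hg : ∀ x, 0 < g x) {m n : ℕ} (hmn : m ≤ n) (f : X → ℝ) :
    classMean T g n (classMean T g m f) = classMean T g n f := by
  obtain ⟨k, rfl⟩ := Nat.exists_eq_add_of_le hmn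
  have h : transfer T g m (classMean T g m f) = transfer T g m f := by
    funext y
    have h1 : transfer T g m (classMean T g m f) y =
        transfer T g m (fun _ => transfer T g m f y / transfer T g m 1 y) y := by
      refine Finset.sum_congr rfl fun u hu => ?_
      rw [(hT.iterate m).mem_fibre] at hu
      simp only [classMean, hu]
    rw [h1, transfer_const, div_mul_cancel₀ _ (transfer_one_pos hT hsurj hg m y).ne']
  funext x
  simp only [classMean]
  rw [transfer_add hT, transfer_add hT k m f, ← h]

theorem classMean_sub_const (hT : IsLocalHomeomorph T) (hsurj : Function.Surjective T)
    (hg : ∀ x, 0 < g x) (n : ℕ) (f : X → ℝ) (a : ℝ) (x : X) :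
    classMean T g n (fun y => f y - a) x = classMean T g n f x - a := by
  have h : (fun y => f y - a) = f + fun _ => -a := by funext y; simp [sub_eq_add_neg]
  have := (transfer_one_pos (g := g) hT hsurj hg n (T^[n] x)).ne'
  simp only [classMean, h, transfer_add_fun, transfer_const]
  field_simp
  ring

theorem classMean_mono (hT : IsLocalHomeomorph T) (hsurj : Function.Surjective T)
    (hg : ∀ x, 0 < g x) (n : ℕ) {u v : X → ℝ} (h : ∀ x, u x ≤ v x) (x : X) :
    classMean T g n u x ≤ classMean T g n v x :=
  div_le_div_of_nonneg_right (transfer_mono hg n h _) (transfer_one_pos hT hsurj hg n _).le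

theorem classMean_const (hT : IsLocalHomeomorph T) (hsurj : Function.Surjective T)
    (hg : ∀ x, 0 < g x) (n : ℕ) (a : ℝ) (x : X) : classMean T g n (fun _ => a) x = a := by
  rw [classMean, transfer_const, mul_div_cancel_right₀ _ (transfer_one_pos hT hsurj hg n _).ne']

end Transfer

/-! ### Bounded distortion and uniform convergence of the conditional means -/

/-- A matching of the fibres compares the transfer operators at two points. -/
theorem transfer_le_of_matching {X : Type*} {S : X → X} {h : X → ℝ}
    (hh : ∀ x, 0 < h x) {Δ : Set (X × X)} {n : ℕ}
    (hdist : ∀ x y, (x, y) ∈ dynEntourage S Δ n → orbitProd S h n x ≤ 2 * orbitProd S h n y)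
    {x x' : X} {τ : X → X} (hτ : InjOn τ (fibre S^[n] x))
    (hτ' : ∀ y ∈ fibre S^[n] x, τ y ∈ fibre S^[n] x' ∧ (y, τ y) ∈ dynEntourage S Δ n)
    {u v : X → ℝ} (hu : ∀ y, 0 ≤ u y) (hv : ∀ y, 0 ≤ v y)
    (huv : ∀ y y', (y, y') ∈ dynEntourage S Δ n → u y ≤ v y') :
    transfer S h n u x ≤ 2 * transfer S h n v x' := by
  classical
  calc transfer S h n u x
      ≤ ∑ y ∈ fibre S^[n] x, 2 * (orbitProd S h n (τ y) * v (τ y)) := by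
        refine Finset.sum_le_sum fun y hy => ?_
        rw [← mul_assoc]
        exact mul_le_mul (hdist _ _ (hτ' y hy).2) (huv _ _ (hτ' y hy).2) (hu y)
          (mul_nonneg zero_le_two (orbitProd_pos hh n _).le)
    _ = 2 * ∑ y ∈ (fibre S^[n] x).image τ, orbitProd S h n y * v y := by
        rw [← Finset.mul_sum, Finset.sum_image hτ]
    _ ≤ 2 * transfer S h n v x' := by
        refine mul_le_mul_of_nonneg_left ?_ zero_le_two
        refine Finset.sum_le_sum_of_subset_of_nonneg (Finset.image_subset_iff.2 fun y hy =>
          (hτ' y hy).1) fun y _ _ => mul_nonneg (orbitProd_pos hh n y).le (hv y)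

section Contraction

variable {X : Type*} [UniformSpace X] [CompactSpace X] {S : X → X} {h : X → ℝ}

/-- Walters' condition for `ε = 1`, in symmetric form at a small scale: `Δ` is expansive, the
weights `h_n` vary by a factor at most two on `Δ_n`, and `S` is injective at the scale `Δ ○ Δ`. -/
theorem WaltersCondition.exists_entourage (hS : IsLocalHomeomorph S) (hh : ∀ x, 0 < h x)
    (hW : WaltersCondition S h) :
    ∃ Δ ∈ 𝓤 X, IsClosed Δ ∧ (⋂ n, dynEntourage S Δ n) ⊆ diagonal X ∧
      (∀ x y, (x, y) ∈ Δ → (y, x) ∈ Δ) ∧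
      (∀ n x y, (x, y) ∈ dynEntourage S Δ n → orbitProd S h n x ≤ 2 * orbitProd S h n y) ∧
      ∀ u v w, (u, w) ∈ Δ → (v, w) ∈ Δ → S u = S v → u = v := by
  obtain ⟨Δ₀, h₀, hd, hv⟩ := hW 1 one_pos
  obtain ⟨E, hE, hinj⟩ := hS.exists_uniform_injective
  obtain ⟨E', hE', hEE⟩ := comp_mem_uniformity_sets hE
  obtain ⟨F, ⟨hF, hFc⟩, hFs⟩ :=
    uniformity_hasBasis_closed.mem_iff.1 (Filter.inter_mem h₀ hE')
  have hsub : F ∩ Prod.swap ⁻¹' F ⊆ Δ₀ := fun p hp => (hFs hp.1).1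
  have hsymm : ∀ x y, (x, y) ∈ F ∩ Prod.swap ⁻¹' F → (y, x) ∈ F ∩ Prod.swap ⁻¹' F :=
    fun x y hp => ⟨hp.2, hp.1⟩
  refine ⟨F ∩ Prod.swap ⁻¹' F, Filter.inter_mem hF (tendsto_swap_uniformity hF),
    hFc.inter (hFc.preimage continuous_swap), ?_, hsymm, fun n x y hxy => ?_, ?_⟩
  · exact (iInter_mono fun n => dynEntourage_mono_left hsub n).trans hd.subset
  · have h1 : ENNReal.ofReal |orbitProd S h n x / orbitProd S h n y - 1| ≤ ENNReal.ofReal 1 :=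
      (le_iSup₂ (f := fun (p : X × X) (_ : p ∈ dynEntourage S Δ₀ n) =>
        ENNReal.ofReal |orbitProd S h n p.1 / orbitProd S h n p.2 - 1|) (x, y)
        (dynEntourage_mono_left hsub n hxy)).trans (hv n)
    have h2 := (abs_le.1 ((ENNReal.ofReal_le_ofReal_iff zero_le_one).1 h1)).2
    rw [← div_le_iff₀ (orbitProd_pos hh n y)]
    linarith
  · intro u v w hu hv' huv
    exact hinj u v (hEE ⟨w, (hFs hu.1).2, (hFs (hsymm _ _ hv').1).2⟩) huv

/-- Uniform form of minimality: for some `m`, every fibre of `S^m` is `E`-dense. -/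
theorem AsympRel.IsMinimal.exists_uniform (hS : IsLocalHomeomorph S)
    (hsurj : Function.Surjective S) (hmin : AsympRel.IsMinimal S) {E : Set (X × X)}
    (hE : E ∈ 𝓤 X) : ∃ m, ∀ x z, ∃ y, S^[m] y = z ∧ (x, y) ∈ E := by
  let Q : ℕ → Set (X × X) := fun m =>
    Prod.map id S^[m] ⁻¹' (Prod.map id S^[m] '' interior E)
  have hQ : ∀ m, IsOpen (Q m) := fun m =>
    ((IsOpenMap.id.prodMap (hS.iterate m).isOpenMap) _ isOpen_interior).preimage
      (continuous_id.prodMap (hS.iterate m).continuous)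
  have hmono : Monotone Q := by
    refine monotone_nat_of_le_succ fun m => ?_
    rintro ⟨x, w⟩ ⟨⟨a, y⟩, hay, he⟩
    obtain ⟨h1, h2⟩ : a = x ∧ S^[m] y = S^[m] w := by simpa using he
    refine ⟨(a, y), hay, ?_⟩
    simp [h1, h2, Function.iterate_succ_apply', -Function.iterate_succ]
  obtain ⟨m, hm⟩ := isCompact_univ.elim_directed_cover Q hQ
    (by
      rintro ⟨x, w⟩ -
      obtain ⟨y, hy, n, hn⟩ := (hmin w).inter_open_nonempty {y | (x, y) ∈ interior E}
        (isOpen_interior.preimage (by fun_prop))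
        ⟨x, refl_mem_uniformity (interior_mem_uniformity hE)⟩
      exact mem_iUnion.2 ⟨n, (x, y), hy, by simp [hn]⟩)
    (directed_of_isDirected_le fun _ _ h => hmono h)
  refine ⟨m, fun x z => ?_⟩
  obtain ⟨w, rfl⟩ := hsurj.iterate m z
  obtain ⟨⟨a, y⟩, hay, he⟩ := hm (mem_univ (x, w))
  obtain ⟨h1, h2⟩ : a = x ∧ S^[m] y = S^[m] w := by simpa using he
  exact ⟨y, h2, h1 ▸ interior_subset hay⟩

variable [T2Space X]

/-- Backward contraction: if `Δ` is expansive, then for `N` large the preimages under `S^n` of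
`Δ_N`-close points are matched injectively in such a way that matched points are
`Δ_{N+n}`-close. -/
theorem exists_fibre_matching (hS : IsLocalHomeomorph S) {Δ : Set (X × X)} (hΔ : Δ ∈ 𝓤 X)
    (hc : IsClosed Δ) (hd : (⋂ n, dynEntourage S Δ n) ⊆ diagonal X)
    (hinj : ∀ u v w, (u, w) ∈ Δ → (v, w) ∈ Δ → S u = S v → u = v) :
    ∃ N, ∀ n x x', (x, x') ∈ dynEntourage S Δ N → ∃ τ : X → X, InjOn τ (fibre S^[n] x) ∧
      ∀ y ∈ fibre S^[n] x, τ y ∈ fibre S^[n] x' ∧ (y, τ y) ∈ dynEntourage S Δ (N + n) := by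
  obtain ⟨δ, hδ, hlift⟩ := hS.exists_uniform_lift hΔ
  obtain ⟨N, hN⟩ := exists_dynEntourage_subset hS.continuous hc hd hδ
  have step : ∀ n x x', (x, x') ∈ dynEntourage S Δ N → ∀ y, S^[n] y = x →
      ∃ y', S^[n] y' = x' ∧ (y, y') ∈ dynEntourage S Δ (N + n) := by
    intro n
    induction n with
    | zero =>
      rintro x x' hx y rfl
      exact ⟨x', rfl, hx⟩
    | succ n ih =>
      intro x x' hx y hy
      obtain ⟨w, hw, hyw⟩ := ih x x' hx (S y) (by rwa [← Function.iterate_succ_apply])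
      obtain ⟨y', rfl, hyy⟩ := hlift y w (hN (dynEntourage_mono (Nat.le_add_right N n) hyw))
      refine ⟨y', by rwa [Function.iterate_succ_apply], fun k hk => ?_⟩
      cases k with
      | zero => exact hyy
      | succ k =>
        simp only [Function.iterate_succ_apply]
        exact hyw k (by omega)
  refine ⟨N, fun n x x' hx => ?_⟩
  choose! τ hτ using step n x x' hx
  have key : ∀ k u v w, S^[k] u = S^[k] v → (u, w) ∈ dynEntourage S Δ k →
      (v, w) ∈ dynEntourage S Δ k → u = v := by
    intro k
    induction k with
    | zero => intro u v w huv _ _; exact huv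
    | succ k ih =>
      intro u v w huv hu hv
      refine ih u v w (hinj _ _ _ (hu k k.lt_succ_self) (hv k k.lt_succ_self) ?_)
        (dynEntourage_mono k.le_succ hu) (dynEntourage_mono k.le_succ hv)
      rwa [← Function.iterate_succ_apply' S, ← Function.iterate_succ_apply' S]
  refine ⟨τ, fun u hu v hv huv => ?_, fun y hy => ?_⟩
  · have hu' := (hS.iterate n).mem_fibre.1 hu
    have hv' := (hS.iterate n).mem_fibre.1 hv
    refine key n u v (τ u) (hu'.trans hv'.symm)
      (dynEntourage_mono (Nat.le_add_left n N) (hτ u hu').2) ?_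
    rw [huv]
    exact dynEntourage_mono (Nat.le_add_left n N) (hτ v hv').2
  · have hy' := (hS.iterate n).mem_fibre.1 hy
    exact ⟨(hS.iterate n).mem_fibre.2 (hτ y hy').1, (hτ y hy').2⟩

/-- The Doeblin type estimate: there are `m` and `c > 0` such that, for every continuous `u ≥ 0`,
the function `P_{n+m} u` is bounded below by `c` times the values of `P_n u`, up to an error which
becomes small for large `n`. -/
theorem exists_classMean_lower_bound [Nonempty X] (hS : IsLocalHomeomorph S)
    (hsurj : Function.Surjective S) (hhc : Continuous h) (hh : ∀ x, 0 < h x)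
    (hmin : AsympRel.IsMinimal S) (hW : WaltersCondition S h) :
    ∃ m : ℕ, ∃ c : ℝ, 0 < c ∧ ∀ u : X → ℝ, Continuous u → (∀ x, 0 ≤ u x) → ∀ η : ℝ, 0 < η →
      ∃ n₀, ∀ n ≥ n₀, ∀ x z, c * (classMean S h n u x - η) ≤ classMean S h (n + m) u z := by
  obtain ⟨Δ, hΔ, hc, hd, hsymm, hdist, hinj⟩ := hW.exists_entourage hS hh
  obtain ⟨N, hN⟩ := exists_fibre_matching hS hΔ hc hd hinj
  obtain ⟨m, hm⟩ := hmin.exists_uniform hS hsurj (dynEntourage_mem_uniformity hS.continuous hΔ N)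
  have hsymm' : ∀ n x y, (x, y) ∈ dynEntourage S Δ n → (y, x) ∈ dynEntourage S Δ n :=
    fun n x y hxy k hk => hsymm _ _ (hxy k hk)
  -- comparison of the transfer operators at close points
  have compare : ∀ n x x', (x, x') ∈ dynEntourage S Δ N → ∀ u v : X → ℝ, (∀ y, 0 ≤ u y) →
      (∀ y, 0 ≤ v y) → (∀ y y', (y, y') ∈ dynEntourage S Δ n → u y ≤ v y') →
      transfer S h n u x ≤ 2 * transfer S h n v x' := by
    intro n x x' hx u v hu hv huv
    obtain ⟨τ, h1, h2⟩ := hN n x x' hx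
    exact transfer_le_of_matching hh (hdist n) h1 (fun y hy => ⟨(h2 y hy).1,
      dynEntourage_mono (Nat.le_add_left n N) (h2 y hy).2⟩) hu hv huv
  have compare_one : ∀ n x x', (x, x') ∈ dynEntourage S Δ N →
      transfer S h n 1 x ≤ 2 * transfer S h n 1 x' := fun n x x' hx =>
    compare n x x' hx 1 1 (fun _ => zero_le_one) (fun _ => zero_le_one) fun _ _ _ => le_rfl
  have hpos := fun n x => transfer_one_pos (g := h) hS hsurj hh n x
  obtain ⟨κ, hκ, hκm⟩ : ∃ κ > 0, ∀ x, κ ≤ orbitProd S h m x := by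
    obtain ⟨x, -, hx⟩ := isCompact_univ.exists_isMinOn univ_nonempty
      (continuous_orbitProd hS.continuous hhc m).continuousOn
    exact ⟨_, orbitProd_pos hh m x, fun y => hx (mem_univ y)⟩
  obtain ⟨C, hC⟩ : ∃ C, ∀ z, transfer S h (m + m) 1 z ≤ C := by
    obtain ⟨x, -, hx⟩ := isCompact_univ.exists_isMaxOn univ_nonempty
      (continuous_transfer hS hhc (m + m) continuous_one).continuousOn
    exact ⟨_, fun y => hx (mem_univ y)⟩
  have hC0 : 0 < C := (hpos _ (Classical.arbitrary X)).trans_le (hC _)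
  -- one term of the sum over the fibre of `S^m`
  have term : ∀ n u, (∀ y, 0 ≤ u y) → ∀ y, κ * transfer S h n u y ≤
      transfer S h (n + m) u (S^[m] y) := by
    intro n u hu y
    have hnn : ∀ y, 0 ≤ transfer S h n u y := fun y =>
      Finset.sum_nonneg fun y _ => mul_nonneg (orbitProd_pos hh n y).le (hu y)
    rw [transfer_add hS]
    refine (mul_le_mul_of_nonneg_right (hκm y) (hnn y)).trans ?_
    exact Finset.single_le_sum (f := fun y => orbitProd S h m y * transfer S h n u y)
      (fun y _ => mul_nonneg (orbitProd_pos hh m y).le (hnn y))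
      ((hS.iterate m).mem_fibre.2 rfl)
  -- the normalising factors at times `n` and `n + m` are comparable, uniformly in `n`
  have norm_le : ∀ n ≥ m, ∀ x z, transfer S h (n + m) 1 z ≤ 2 * C / κ * transfer S h n 1 x := by
    intro n hn x z
    obtain ⟨k, rfl⟩ := Nat.exists_eq_add_of_le' hn
    have h1 : ∀ w, κ * transfer S h k 1 w ≤ 2 * transfer S h (k + m) 1 x := by
      intro w
      obtain ⟨y, rfl, hy⟩ := hm w x
      have h2 := compare_one k _ _ hy
      have h3 := term k 1 (fun _ => zero_le_one) y
      nlinarith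
    have h4 : transfer S h (m + m) (transfer S h k 1) z ≤
        transfer S h (m + m) (fun _ => 2 / κ * transfer S h (k + m) 1 x) z := by
      refine transfer_mono hh _ (fun w => ?_) z
      rw [div_mul_eq_mul_div, le_div_iff₀ hκ, mul_comm]
      exact h1 w
    rw [add_assoc, transfer_add hS]
    refine h4.trans ?_
    rw [transfer_const]
    refine (mul_le_mul_of_nonneg_left (hC z)
      (mul_nonneg (by positivity) (hpos _ x).le)).trans (le_of_eq ?_)
    ring
  refine ⟨m, κ ^ 2 / (4 * C), by positivity, fun u huc hu η hη => ?_⟩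
  obtain ⟨n₁, hn₁⟩ := exists_dynEntourage_subset hS.continuous hc hd
    (CompactSpace.uniformContinuous_of_continuous huc (Metric.dist_mem_uniformity
      (show 0 < η / 4 by positivity)))
  refine ⟨max n₁ m, fun n hn x z => ?_⟩
  simp only [classMean]
  generalize S^[n] x = x'
  generalize S^[n + m] z = z'
  obtain ⟨y, rfl, hy⟩ := hm x' z'
  have hA := hpos n x'
  have hB := hpos (n + m) (S^[m] y)
  have h1 : transfer S h n u x' ≤ 2 * (transfer S h n u y + η / 4 * transfer S h n 1 y) := by
    rw [← transfer_const, ← transfer_add_fun]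
    refine compare n x' y hy u _ hu (fun y => add_nonneg (hu y) (by positivity)) ?_
    intro a b hab
    have := hn₁ (dynEntourage_mono (le_of_max_le_left hn) hab)
    have h2 : |u a - u b| < η / 4 := this
    simp only [Pi.add_apply]
    linarith [(abs_lt.1 h2).2]
  have h2 := compare_one n y x' (hsymm' _ _ _ hy)
  have h3 := term n u hu y
  have h4 := norm_le n (le_of_max_le_right hn) x' (S^[m] y)
  by_cases hneg : transfer S h n u x' / transfer S h n 1 x' - η ≤ 0
  · refine (mul_nonpos_of_nonneg_of_nonpos (by positivity) hneg).trans ?_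
    exact div_nonneg (Finset.sum_nonneg fun y _ => mul_nonneg (orbitProd_pos hh _ y).le (hu y))
      hB.le
  · have h5 : 0 < transfer S h n u x' - η * transfer S h n 1 x' := by
      rw [not_le, sub_pos, lt_div_iff₀ hA] at hneg
      linarith
    rw [le_div_iff₀ hB]
    calc κ ^ 2 / (4 * C) * (transfer S h n u x' / transfer S h n 1 x' - η) *
          transfer S h (n + m) 1 (S^[m] y)
        ≤ κ ^ 2 / (4 * C) * (transfer S h n u x' / transfer S h n 1 x' - η) *
          (2 * C / κ * transfer S h n 1 x') := by
          refine mul_le_mul_of_nonneg_left h4 (mul_nonneg (by positivity) (not_le.1 hneg).le)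
      _ = κ / 2 * (transfer S h n u x' - η * transfer S h n 1 x') := by
          field_simp
          ring
      _ ≤ κ * transfer S h n u y := by
          have h6 : transfer S h n u x' - η * transfer S h n 1 x' ≤ 2 * transfer S h n u y := by
            linarith [mul_le_mul_of_nonneg_left h2 (show 0 ≤ η / 2 by positivity)]
          linarith [mul_le_mul_of_nonneg_left h6 (show 0 ≤ κ / 2 by positivity)]
      _ ≤ _ := h3

/-- The conditional means of a continuous function converge uniformly to a constant. -/
theorem exists_classMean_limit [Nonempty X] (hS : IsLocalHomeomorph S)
    (hsurj : Function.Surjective S) (hhc : Continuous h) (hh : ∀ x, 0 < h x)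
    (hmin : AsympRel.IsMinimal S) (hW : WaltersCondition S h) {f : X → ℝ} (hf : Continuous f) :
    ∃ A : ℝ, ∀ ε > 0, ∃ n₀, ∀ n ≥ n₀, ∀ x, |classMean S h n f x - A| ≤ ε := by
  obtain ⟨m, c, hc, hlow⟩ := exists_classMean_lower_bound hS hsurj hhc hh hmin hW
  -- the limit is the supremum of all lower bounds of the functions `P_k f`
  set B : Set ℝ := {a | ∃ k, ∀ x, a ≤ classMean S h k f x} with hB
  obtain ⟨x₁, -, hx₁⟩ := isCompact_univ.exists_isMinOn univ_nonempty hf.continuousOn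
  obtain ⟨x₂, -, hx₂⟩ := isCompact_univ.exists_isMaxOn univ_nonempty hf.continuousOn
  have hne : B.Nonempty := by
    refine ⟨f x₁, 0, fun x => ?_⟩
    rw [← classMean_const hS hsurj hh 0 (f x₁) x]
    exact classMean_mono hS hsurj hh 0 (fun y => hx₁ (mem_univ y)) x
  have hbdd : BddAbove B := by
    refine ⟨f x₂, ?_⟩
    rintro a ⟨k, hk⟩
    refine (hk x₁).trans ?_
    rw [← classMean_const hS hsurj hh k (f x₂) x₁]
    exact classMean_mono hS hsurj hh k (fun y => hx₂ (mem_univ y)) x₁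
  refine ⟨sSup B, fun ε hε => ?_⟩
  have hcε : 0 < min ε (c * (ε / 2)) := lt_min hε (by positivity)
  obtain ⟨a, ⟨k, hk⟩, ha⟩ := exists_lt_of_lt_csSup hne (sub_lt_self (sSup B) hcε)
  have haB : a ≤ sSup B := le_csSup hbdd ⟨k, hk⟩
  have hmean : ∀ n ≥ k, ∀ x,
      classMean S h n (fun y => classMean S h k f y - a) x = classMean S h n f x - a := by
    intro n hn x
    rw [classMean_sub_const hS hsurj hh, classMean_classMean hS hsurj hh hn]
  obtain ⟨n₀, hn₀⟩ := hlow (fun y => classMean S h k f y - a)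
    ((continuous_classMean hS hsurj hhc hh k hf).sub continuous_const)
    (fun x => sub_nonneg.2 (hk x)) (ε / 2) (by positivity)
  refine ⟨max n₀ k, fun n hn x => ?_⟩
  have hnk := le_of_max_le_right hn
  have h1 : a ≤ classMean S h n f x := by
    rw [← classMean_classMean hS hsurj hh hnk, ← classMean_const hS hsurj hh n a x]
    exact classMean_mono hS hsurj hh n hk x
  have h2 : a + c * (classMean S h n f x - a - ε / 2) ≤ sSup B := by
    refine le_csSup hbdd ⟨n + m, fun z => ?_⟩
    have := hn₀ n (le_of_max_le_left hn) x z
    rw [hmean n hnk, hmean (n + m) (hnk.trans (Nat.le_add_right _ _))] at this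
    linarith
  have h3 : classMean S h n f x - a - ε / 2 < ε / 2 := by
    refine lt_of_mul_lt_mul_left ?_ hc.le
    linarith [min_le_right ε (c * (ε / 2))]
  rw [abs_le]
  constructor <;> linarith [min_le_left ε (c * (ε / 2))]

end Contraction

/-! ### Measurability on the groupoid -/

theorem measurable_of_isOpen_cover {X Y : Type*} [TopologicalSpace X] [CompactSpace X]
    [MeasurableSpace X] [BorelSpace X] [MeasurableSpace Y] {f : X → Y}
    (h : ∀ x, ∃ W : Set X, IsOpen W ∧ x ∈ W ∧ Measurable (W.domRestrict f)) : Measurable f := by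
  choose W hW hxW hf using h
  obtain ⟨s, -, hs⟩ := isCompact_univ.elim_nhds_subcover W fun x _ => (hW x).mem_nhds (hxW x)
  intro t ht
  have : f ⁻¹' t = ⋃ x ∈ s, Subtype.val '' ((W x).domRestrict f ⁻¹' t) := by
    ext y
    simp only [mem_preimage, mem_iUnion, mem_image, exists_prop]
    constructor
    · intro hy
      obtain ⟨x, hx, hyx⟩ := mem_iUnion₂.1 (hs (mem_univ y))
      exact ⟨x, hx, ⟨y, hyx⟩, hy, rfl⟩
    · rintro ⟨x, -, z, hz, rfl⟩
      exact hz
  rw [this]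
  exact s.measurableSet_biUnion fun x _ => (hW x).measurableSet.subtype_image (hf x ht)

section Groupoid

variable {X : Type*} {T : X → X}

namespace AsympRel

/-- The class of `x` for the equivalence relation `R_n`, as a finite set. -/
noncomputable def levelClass (T : X → X) (n : ℕ) (x : X) : Finset X := fibre T^[n] (T^[n] x)

/-- The subset `R_n` of `R(X,T)`. -/
def level (T : X → X) (n : ℕ) : Set (AsympRel T) := {γ | T^[n] γ.r = T^[n] γ.s}

theorem iUnion_level : ⋃ n, level T n = univ :=
  eq_univ_of_forall fun γ => mem_iUnion.2 γ.2

theorem monotone_level : Monotone (level T) := by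
  refine monotone_nat_of_le_succ fun n γ (hγ : _ = _) => ?_
  simp only [level, mem_ofPred_eq, Function.iterate_succ_apply', hγ]

theorem inv_mem_level {n : ℕ} {γ : AsympRel T} : γ.inv ∈ level T n ↔ γ ∈ level T n :=
  ⟨Eq.symm, Eq.symm⟩

open Classical in
/-- A function on `R(X,T)` regarded as a function of two variables in `X`, extended by zero. -/
noncomputable def extend (F : AsympRel T → ℝ≥0∞) (x y : X) : ℝ≥0∞ :=
  if h : ∃ n, T^[n] x = T^[n] y then F ⟨(x, y), h⟩ else 0

theorem extend_of_eq (F : AsympRel T → ℝ≥0∞) {n : ℕ} {x y : X} (h : T^[n] x = T^[n] y) :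
    extend F x y = F ⟨(x, y), n, h⟩ :=
  dif_pos ⟨n, h⟩

theorem extend_comp_inv (F : AsympRel T → ℝ≥0∞) (x y : X) :
    extend (F ∘ inv) x y = extend F y x := by
  classical
  by_cases h : ∃ n, T^[n] x = T^[n] y
  · obtain ⟨n, hn⟩ := h
    rw [extend_of_eq _ hn, extend_of_eq _ hn.symm]
    rfl
  · have h' : ¬ ∃ n, T^[n] y = T^[n] x := fun ⟨n, hn⟩ => h ⟨n, hn.symm⟩
    rw [extend, extend, dif_neg h, dif_neg h']

variable [TopologicalSpace X]

theorem continuous_iff {Y : Type*} [TopologicalSpace Y] {f : AsympRel T → Y} :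
    Continuous f ↔ ∀ n, Continuous (f ∘ ofLevel n) := by
  rw [continuous_iSup_dom]
  exact forall_congr' fun n => continuous_coinduced_dom

theorem continuous_ofLevel (n : ℕ) : Continuous (ofLevel (T := T) n) :=
  continuous_iff.1 continuous_id n

theorem continuous_r : Continuous (r (T := T)) :=
  continuous_iff.2 fun _ => continuous_fst.comp continuous_subtype_val

theorem continuous_s : Continuous (s (T := T)) :=
  continuous_iff.2 fun _ => continuous_snd.comp continuous_subtype_val

theorem continuous_inv : Continuous (inv (T := T)) := by
  refine continuous_iff.2 fun n => ?_
  have h : Continuous fun p : Level T n => (⟨p.1.swap, p.2.symm⟩ : Level T n) := by fun_prop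
  exact (continuous_ofLevel n).comp h

variable [T2Space X]

theorem measurableSet_level (hT : Continuous T) (n : ℕ) : MeasurableSet (level T n) :=
  (isClosed_eq ((hT.iterate n).comp continuous_r) ((hT.iterate n).comp continuous_s)).measurableSet

variable [CompactSpace X]

theorem mem_levelClass (hT : IsLocalHomeomorph T) {n : ℕ} {x y : X} :
    y ∈ levelClass T n x ↔ T^[n] y = T^[n] x := (hT.iterate n).mem_fibre

theorem levelClass_eq (hT : IsLocalHomeomorph T) {n : ℕ} {x y : X} (h : y ∈ levelClass T n x) :
    levelClass T n y = levelClass T n x := by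
  rw [levelClass, (mem_levelClass hT).1 h, levelClass]

variable [MeasurableSpace X] [BorelSpace X]

theorem measurable_sum_levelClass (hT : IsLocalHomeomorph T) (n : ℕ) {F : AsympRel T → ℝ≥0∞}
    (hF : Measurable F) : Measurable fun x => ∑ y ∈ levelClass T n x, extend F x y := by
  classical
  have hTn := hT.iterate n
  refine measurable_of_isOpen_cover fun x₀ => ?_
  obtain ⟨V, hV, hx₀, σ, hσ, h⟩ := hTn.exists_local_sections (T^[n] x₀)
  have : Fintype (T^[n] ⁻¹' {T^[n] x₀}) := (hTn.finite_preimage_singleton _).fintype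
  refine ⟨T^[n] ⁻¹' V, hV.preimage hTn.continuous, hx₀, ?_⟩
  have hs : ∀ (x : T^[n] ⁻¹' V) i, T^[n] x.1 = T^[n] (σ i (T^[n] x.1)) := fun x i =>
    (((h _ x.2).2 _).2 ⟨i, rfl⟩).symm
  have hc : ∀ i, Continuous fun x : T^[n] ⁻¹' V =>
      (⟨(x.1, σ i (T^[n] x.1)), hs x i⟩ : Level T n) := fun i => by
    refine Continuous.subtype_mk (continuous_subtype_val.prodMk ?_) _
    exact (hσ i).comp_continuous (hTn.continuous.comp continuous_subtype_val) fun x => x.2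
  have key : (T^[n] ⁻¹' V).domRestrict (fun x => ∑ y ∈ levelClass T n x, extend F x y) =
      fun x => ∑ i, F (ofLevel n ⟨(x.1, σ i (T^[n] x.1)), hs x i⟩) := by
    funext x
    have hcl : levelClass T n x.1 = Finset.univ.image fun i => σ i (T^[n] x.1) := by
      ext y
      rw [mem_levelClass hT, (h _ x.2).2]
      simp
    simp only [domRestrict_apply]
    rw [hcl, Finset.sum_image fun i _ j _ hij => (h _ x.2).1 hij]
    exact Finset.sum_congr rfl fun i _ => extend_of_eq F (hs x i)
  rw [key]
  exact Finset.measurable_sum _ fun i _ =>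
    hF.comp ((continuous_ofLevel n).comp (hc i)).measurable

end AsympRel

open AsympRel

/-! ### The measures `μ ∘ λ` and `(μ ∘ λ)⁻¹` -/

variable [TopologicalSpace X] [CompactSpace X] [T2Space X]

theorem setLIntegral_level_haarSystem (hT : IsLocalHomeomorph T) (n : ℕ)
    {F : AsympRel T → ℝ≥0∞} (hF : Measurable F) (x : X) :
    ∫⁻ γ in level T n, F γ ∂haarSystem T x = ∑ y ∈ levelClass T n x, extend F x y := by
  classical
  have hE := measurableSet_level hT.continuous n
  have hcl : ∀ y ∈ levelClass T n x, T^[n] x = T^[n] y := fun y hy =>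
    ((mem_levelClass hT).1 hy).symm
  rw [← lintegral_indicator hE, haarSystem, lintegral_sum_measure]
  simp_rw [lintegral_dirac' _ (hF.indicator hE)]
  let j : levelClass T n x → {γ : AsympRel T // γ.r = x} := fun y =>
    ⟨⟨(x, y.1), n, hcl y.1 y.2⟩, rfl⟩
  have hj : Function.Injective j := fun y z hyz =>
    Subtype.ext (congrArg (fun γ => γ.1.s) hyz)
  rw [← hj.tsum_eq (f := fun γ => (level T n).indicator F γ.1)]
  · rw [tsum_fintype, ← Finset.sum_coe_sort (levelClass T n x)]
    refine Finset.sum_congr rfl fun y _ => ?_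
    rw [extend_of_eq F (hcl y.1 y.2), indicator_of_mem]
    exact hcl y.1 y.2
  · rintro ⟨γ, rfl⟩ hγ
    have hl : γ ∈ level T n := by
      by_contra hno
      exact hγ (indicator_of_notMem hno _)
    exact ⟨(⟨γ.s, (mem_levelClass hT).2 hl.symm⟩ : levelClass T n γ.r), rfl⟩

variable [MeasurableSpace X] [BorelSpace X]

theorem measurable_haarSystem (hT : IsLocalHomeomorph T) : Measurable (haarSystem T) := by
  refine Measure.measurable_of_measurable_coe _ fun A hA => ?_
  have h : ∀ x, haarSystem T x A =
      ⨆ n, ∑ y ∈ levelClass T n x, extend (A.indicator 1) x y := fun x => by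
    have hA' : A = ⋃ n, A ∩ level T n := by rw [← inter_iUnion, iUnion_level, inter_univ]
    have hm : Monotone fun n => A ∩ level T n := fun m n hmn =>
      inter_subset_inter_right _ (monotone_level hmn)
    conv_lhs => rw [hA', hm.measure_iUnion]
    refine iSup_congr fun n => ?_
    rw [← setLIntegral_level_haarSystem hT n (measurable_one.indicator hA),
      lintegral_indicator_one hA, Measure.restrict_apply hA]
  simp_rw [h]
  exact .iSup fun n => measurable_sum_levelClass hT n (measurable_one.indicator hA)

theorem setLIntegral_level_haarMeasure (hT : IsLocalHomeomorph T) (μ : Measure X) (n : ℕ)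
    {F : AsympRel T → ℝ≥0∞} (hF : Measurable F) :
    ∫⁻ γ in level T n, F γ ∂haarMeasure T μ =
      ∫⁻ x, ∑ y ∈ levelClass T n x, extend F x y ∂μ := by
  have hE := measurableSet_level hT.continuous n
  rw [← lintegral_indicator hE, haarMeasure,
    Measure.lintegral_bind (measurable_haarSystem hT).aemeasurable (hF.indicator hE).aemeasurable]
  simp_rw [lintegral_indicator hE, setLIntegral_level_haarSystem hT n hF]

theorem setLIntegral_level_haarMeasureInv (hT : IsLocalHomeomorph T) (μ : Measure X) (n : ℕ)
    {F : AsympRel T → ℝ≥0∞} (hF : Measurable F) :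
    ∫⁻ γ in level T n, F γ ∂haarMeasureInv T μ =
      ∫⁻ x, ∑ y ∈ levelClass T n x, extend F y x ∂μ := by
  have hE := measurableSet_level hT.continuous n
  have hi := (continuous_inv (T := T)).measurable
  rw [haarMeasureInv, setLIntegral_map hE hF hi]
  have h : inv ⁻¹' level T n = level T n := ext fun γ => inv_mem_level
  rw [h]
  have := setLIntegral_level_haarMeasure hT μ n (hF.comp hi)
  simp_rw [extend_comp_inv] at this
  exact this

end Groupoid

/-! ### Solutions of the Radon-Nikodym problem and invariance under the conditional means -/

section Solutions

open AsympRel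

variable {X : Type*} {T : X → X} {g : X → ℝ}

/-- The weight of `x` in its `R_n`-class: `g_n(x)`, normalised to have total mass one on each
class. -/
noncomputable def classWeight (T : X → X) (g : X → ℝ) (n : ℕ) (x : X) : ℝ :=
  orbitProd T g n x / transfer T g n 1 (T^[n] x)

/-- The probability measure on the `R_n`-class of `x` which gives the points their weights. -/
noncomputable def classKernel [MeasurableSpace X] (T : X → X) (g : X → ℝ) (n : ℕ) (x : X) :
    Measure X :=
  ∑ y ∈ levelClass T n x, ENNReal.ofReal (classWeight T g n y) • Measure.dirac y

theorem lintegral_classKernel [MeasurableSpace X] (n : ℕ) {φ : X → ℝ≥0∞} (hφ : Measurable φ)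
    (x : X) : ∫⁻ y, φ y ∂classKernel T g n x =
      ∑ y ∈ levelClass T n x, ENNReal.ofReal (classWeight T g n y) * φ y := by
  rw [classKernel, lintegral_finsetSum_measure]
  refine Finset.sum_congr rfl fun y _ => ?_
  rw [lintegral_smul_measure, lintegral_dirac' _ hφ, smul_eq_mul]

variable [TopologicalSpace X] [CompactSpace X] [T2Space X]

theorem sum_classWeight_mul (hT : IsLocalHomeomorph T) (n : ℕ) (f : X → ℝ) (x : X) :
    ∑ y ∈ levelClass T n x, classWeight T g n y * f y = classMean T g n f x := by
  rw [classMean, transfer, Finset.sum_div]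
  refine Finset.sum_congr rfl fun y hy => ?_
  rw [classWeight, (mem_levelClass hT).1 hy, div_mul_eq_mul_div]

theorem classWeight_nonneg (hT : IsLocalHomeomorph T) (hsurj : Function.Surjective T)
    (hg : ∀ x, 0 < g x) (n : ℕ) (x : X) : 0 ≤ classWeight T g n x :=
  (div_pos (orbitProd_pos hg n x) (transfer_one_pos hT hsurj hg n _)).le

theorem continuous_classWeight (hT : IsLocalHomeomorph T) (hsurj : Function.Surjective T)
    (hgc : Continuous g) (hg : ∀ x, 0 < g x) (n : ℕ) : Continuous (classWeight T g n) :=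
  (continuous_orbitProd hT.continuous hgc n).div
    ((continuous_transfer hT hgc n continuous_one).comp (hT.iterate n).continuous)
    fun _ => (transfer_one_pos hT hsurj hg n _).ne'

theorem sum_ofReal_classWeight (hT : IsLocalHomeomorph T) (hsurj : Function.Surjective T)
    (hg : ∀ x, 0 < g x) (n : ℕ) (x : X) :
    ∑ y ∈ levelClass T n x, ENNReal.ofReal (classWeight T g n y) = 1 := by
  rw [← ENNReal.ofReal_sum_of_nonneg fun y _ => classWeight_nonneg hT hsurj hg n y]
  have := sum_classWeight_mul (g := g) hT n (fun _ => 1) x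
  simp only [mul_one, classMean_const hT hsurj hg] at this
  rw [this, ENNReal.ofReal_one]

/-- Within an `R_n`-class, the weights are related by the cocycle. -/
theorem extend_mul_stationaryFun (hT : IsLocalHomeomorph T) (hg : ∀ x, 0 < g x)
    (F : AsympRel T → ℝ≥0∞) {n : ℕ} {x y : X} (hy : y ∈ levelClass T n x) :
    ENNReal.ofReal (classWeight T g n x) *
      extend (fun γ => ENNReal.ofReal (stationaryFun T g γ) * F γ) y x =
      ENNReal.ofReal (classWeight T g n y) * extend F y x := by
  have h := (mem_levelClass hT).1 hy
  rw [extend_of_eq _ h, extend_of_eq _ h, stationaryFun_eq hg ⟨(y, x), n, h⟩ h, ← mul_assoc,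
    ← ENNReal.ofReal_mul' (div_pos (orbitProd_pos hg _ _) (orbitProd_pos hg _ _)).le]
  congr 2
  have := (orbitProd_pos (T := T) hg n x).ne'
  simp only [classWeight, AsympRel.r, AsympRel.s, h]
  field_simp

variable [MeasurableSpace X]

theorem isProbabilityMeasure_classKernel (hT : IsLocalHomeomorph T) (hsurj : Function.Surjective T)
    (hg : ∀ x, 0 < g x) (n : ℕ) (x : X) : IsProbabilityMeasure (classKernel T g n x) := by
  constructor
  rw [← lintegral_one, lintegral_classKernel n measurable_const]
  simpa using sum_ofReal_classWeight hT hsurj hg n x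

variable [BorelSpace X]

theorem integral_classKernel (hT : IsLocalHomeomorph T) (hsurj : Function.Surjective T)
    (hg : ∀ x, 0 < g x) (n : ℕ) {f : X → ℝ} (hf : Continuous f) (x : X) :
    ∫ y, f y ∂classKernel T g n x = classMean T g n f x := by
  rw [classKernel, integral_finsetSum_measure, ← sum_classWeight_mul hT]
  · refine Finset.sum_congr rfl fun y _ => ?_
    rw [integral_smul_measure, integral_dirac' _ _ (hf.stronglyMeasurable_of_hasCompactSupport
      (HasCompactSupport.of_compactSpace f)),
      ENNReal.toReal_ofReal (classWeight_nonneg hT hsurj hg n y), smul_eq_mul]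
  · intro y _
    exact (hf.integrable_of_hasCompactSupport (HasCompactSupport.of_compactSpace f)).smul_measure
      ENNReal.ofReal_ne_top

theorem measurable_classKernel (hT : IsLocalHomeomorph T) (hsurj : Function.Surjective T)
    (hgc : Continuous g) (hg : ∀ x, 0 < g x) (n : ℕ) : Measurable (classKernel T g n) := by
  refine Measure.measurable_of_measurable_coe _ fun A hA => ?_
  have hw := (continuous_classWeight hT hsurj hgc hg n).measurable.ennreal_ofReal
  have h : ∀ x, classKernel T g n x A = ∑ y ∈ levelClass T n x,
      extend (T := T)
        (fun γ => ENNReal.ofReal (classWeight T g n γ.s) * A.indicator 1 γ.s) x y := by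
    intro x
    rw [← lintegral_indicator_one hA, lintegral_classKernel n (measurable_one.indicator hA)]
    refine Finset.sum_congr rfl fun y hy => ?_
    rw [extend_of_eq _ ((mem_levelClass hT).1 hy).symm]
    rfl
  simp_rw [h]
  exact measurable_sum_levelClass hT n
    ((hw.mul (measurable_one.indicator hA)).comp continuous_s.measurable)

/-- Invariance of `μ` under all the conditional means `P_n`, tested on continuous functions. -/
def IsMeanInvariant (T : X → X) (g : X → ℝ) (μ : Measure X) : Prop :=
  ∀ n, ∀ f : X → ℝ, Continuous f → ∫ x, classMean T g n f x ∂μ = ∫ x, f x ∂μ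

/-- A solution is invariant under the kernels of the classes: test the defining equation against
the function `(x, y) ↦ φ(x) p_n(y)` on `R_n`, where `p_n` is the weight `classWeight`. -/
theorem lintegral_classKernel_of_solution (hT : IsLocalHomeomorph T)
    (hsurj : Function.Surjective T) (hgc : Continuous g) (hg : ∀ x, 0 < g x)
    {μ : ProbabilityMeasure X}
    (hμ : μ ∈ (stationaryCocycle T hT.continuous g hgc hg).solutions) (n : ℕ) {φ : X → ℝ≥0∞}
    (hφ : Measurable φ) :
    ∫⁻ x, ∫⁻ y, φ y ∂classKernel T g n x ∂(μ : Measure X) = ∫⁻ x, φ x ∂(μ : Measure X) := by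
  have hw := (continuous_classWeight hT hsurj hgc hg n).measurable.ennreal_ofReal
  have hD : Measurable fun γ => ENNReal.ofReal (stationaryFun T g γ) :=
    (stationaryCocycle T hT.continuous g hgc hg).continuous.measurable.ennreal_ofReal
  have hE := measurableSet_level hT.continuous n
  let F : AsympRel T → ℝ≥0∞ := fun γ => φ γ.r * ENNReal.ofReal (classWeight T g n γ.s)
  have hF : Measurable F :=
    (hφ.comp continuous_r.measurable).mul (hw.comp continuous_s.measurable)
  have hDF : Measurable fun γ => ENNReal.ofReal (stationaryFun T g γ) * F γ := hD.mul hF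
  have h : ∫⁻ γ in level T n, F γ ∂haarMeasure T μ =
      ∫⁻ γ in level T n, ENNReal.ofReal (stationaryFun T g γ) * F γ ∂haarMeasureInv T μ := by
    have h0 : haarMeasure T (μ : Measure X) = (haarMeasureInv T (μ : Measure X)).withDensity
        fun γ => ENNReal.ofReal (stationaryFun T g γ) := hμ.2
    rw [h0, setLIntegral_withDensity_eq_setLIntegral_mul _ hD hF hE]
    rfl
  rw [setLIntegral_level_haarMeasure hT _ n hF,
    setLIntegral_level_haarMeasureInv hT _ n hDF] at h
  have h1 : ∀ x, ∑ y ∈ levelClass T n x, extend F x y = φ x := fun x => by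
    rw [← mul_one (φ x), ← sum_ofReal_classWeight hT hsurj hg n x, Finset.mul_sum]
    refine Finset.sum_congr rfl fun y hy => ?_
    rw [extend_of_eq _ ((mem_levelClass hT).1 hy).symm]
    rfl
  have h2 : ∀ x, ∑ y ∈ levelClass T n x,
      extend (fun γ => ENNReal.ofReal (stationaryFun T g γ) * F γ) y x =
      ∫⁻ y, φ y ∂classKernel T g n x := fun x => by
    rw [lintegral_classKernel n hφ]
    refine Finset.sum_congr rfl fun y hy => ?_
    have hy' := (mem_levelClass hT).1 hy
    have := extend_mul_stationaryFun hT hg (φ ∘ r) hy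
    rw [extend_of_eq (φ ∘ r) hy'] at this
    refine Eq.trans ?_ this
    rw [extend_of_eq _ hy', extend_of_eq _ hy']
    exact (mul_assoc _ _ _).symm.trans (mul_comm _ _)
  have h3 := h.symm
  simp only [h1] at h3
  rw [← h3]
  exact lintegral_congr fun x => (h2 x).symm

/-- Under a measure invariant under the kernels of the classes, the defining equation of a solution
holds on `R_n`: after averaging over a class, both sides are the double sum of `p_n(x) F(x, y)` over
the pairs of points in the class. -/
theorem setLIntegral_level_eq_of_invariant (hT : IsLocalHomeomorph T)
    (hgc : Continuous g) (hg : ∀ x, 0 < g x) {μ : Measure X} (n : ℕ)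
    (hμ : ∀ φ : X → ℝ≥0∞, Measurable φ →
      ∫⁻ x, ∫⁻ y, φ y ∂classKernel T g n x ∂μ = ∫⁻ x, φ x ∂μ)
    {F : AsympRel T → ℝ≥0∞} (hF : Measurable F) :
    ∫⁻ γ in level T n, F γ ∂haarMeasure T μ =
      ∫⁻ γ in level T n, ENNReal.ofReal (stationaryFun T g γ) * F γ ∂haarMeasureInv T μ := by
  have hD : Measurable fun γ => ENNReal.ofReal (stationaryFun T g γ) :=
    (stationaryCocycle T hT.continuous g hgc hg).continuous.measurable.ennreal_ofReal
  have hDF : Measurable fun γ => ENNReal.ofReal (stationaryFun T g γ) * F γ := hD.mul hF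
  have hm1 := measurable_sum_levelClass hT n hF
  have hm2 : Measurable fun x => ∑ y ∈ levelClass T n x,
      extend (fun γ => ENNReal.ofReal (stationaryFun T g γ) * F γ) y x := by
    have := measurable_sum_levelClass hT n (hDF.comp continuous_inv.measurable)
    simp_rw [extend_comp_inv] at this
    exact this
  rw [setLIntegral_level_haarMeasure hT _ n hF,
    setLIntegral_level_haarMeasureInv hT _ n hDF, ← hμ _ hm1]
  refine Eq.trans ?_ (hμ _ hm2)
  refine lintegral_congr fun x => ?_
  rw [lintegral_classKernel n hm1, lintegral_classKernel n hm2]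
  simp only [Finset.mul_sum]
  have hl : ∀ z ∈ levelClass T n x, ∑ y ∈ levelClass T n z,
      ENNReal.ofReal (classWeight T g n z) * extend F z y =
      ∑ y ∈ levelClass T n x, ENNReal.ofReal (classWeight T g n z) * extend F z y := fun z hz => by
    rw [levelClass_eq hT hz]
  have hr : ∀ z ∈ levelClass T n x, ∑ y ∈ levelClass T n z, ENNReal.ofReal (classWeight T g n z) *
      extend (fun γ => ENNReal.ofReal (stationaryFun T g γ) * F γ) y z =
      ∑ y ∈ levelClass T n x, ENNReal.ofReal (classWeight T g n y) * extend F y z := fun z hz => by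
    rw [← levelClass_eq hT hz]
    exact Finset.sum_congr rfl fun y hy => extend_mul_stationaryFun hT hg F hy
  rw [Finset.sum_congr rfl hl, Finset.sum_congr rfl hr, Finset.sum_comm]

theorem isMeanInvariant_of_solution (hT : IsLocalHomeomorph T)
    (hsurj : Function.Surjective T) (hgc : Continuous g) (hg : ∀ x, 0 < g x)
    {μ : ProbabilityMeasure X}
    (hμ : μ ∈ (stationaryCocycle T hT.continuous g hgc hg).solutions) :
    IsMeanInvariant T g μ := by
  intro n f hf
  have := isProbabilityMeasure_classKernel hT hsurj hg n
  have hint : ∀ (ν : Measure X) [IsFiniteMeasure ν] {f : X → ℝ}, Continuous f → Integrable f ν :=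
    fun ν _ f hf => hf.integrable_of_hasCompactSupport (HasCompactSupport.of_compactSpace f)
  -- the case of nonnegative functions
  have pos : ∀ u : X → ℝ, Continuous u → (∀ x, 0 ≤ u x) →
      ∫ x, classMean T g n u x ∂(μ : Measure X) = ∫ x, u x ∂(μ : Measure X) := by
    intro u hu hu0
    have hc := continuous_classMean hT hsurj hgc hg n hu
    have hc0 : ∀ x, 0 ≤ classMean T g n u x := fun x => by
      rw [← integral_classKernel hT hsurj hg n hu]
      exact integral_nonneg hu0
    rw [integral_eq_lintegral_of_nonneg_ae (.of_forall hc0) (hint _ hc).aestronglyMeasurable,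
      integral_eq_lintegral_of_nonneg_ae (.of_forall hu0) (hint _ hu).aestronglyMeasurable,
      ← lintegral_classKernel_of_solution hT hsurj hgc hg hμ n hu.measurable.ennreal_ofReal]
    congr 1
    refine lintegral_congr fun x => ?_
    rw [← integral_classKernel hT hsurj hg n hu,
      ofReal_integral_eq_lintegral_ofReal (hint _ hu) (.of_forall hu0)]
  obtain ⟨C, hC⟩ := (isCompact_range hf).bddBelow
  have h := pos (fun x => f x - C) (hf.sub continuous_const)
    fun x => sub_nonneg.2 (hC (mem_range_self x))
  simp only [classMean_sub_const hT hsurj hg] at h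
  rw [integral_sub (hint _ (continuous_classMean hT hsurj hgc hg n hf)) (integrable_const _),
    integral_sub (hint _ hf) (integrable_const _)] at h
  linarith

theorem solution_of_isMeanInvariant [HasOuterApproxClosed X] (hT : IsLocalHomeomorph T)
    (hsurj : Function.Surjective T) (hgc : Continuous g) (hg : ∀ x, 0 < g x)
    {μ : ProbabilityMeasure X} (hμ : IsMeanInvariant T g μ) :
    μ ∈ (stationaryCocycle T hT.continuous g hgc hg).solutions := by
  have hint : ∀ (ν : Measure X) [IsFiniteMeasure ν] {f : X → ℝ}, Continuous f → Integrable f ν :=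
    fun ν _ f hf => hf.integrable_of_hasCompactSupport (HasCompactSupport.of_compactSpace f)
  have hD : Measurable fun γ => ENNReal.ofReal (stationaryFun T g γ) :=
    (stationaryCocycle T hT.continuous g hgc hg).continuous.measurable.ennreal_ofReal
  -- invariance for continuous functions extends to measurable functions
  have inv : ∀ n, ∀ φ : X → ℝ≥0∞, Measurable φ →
      ∫⁻ x, ∫⁻ y, φ y ∂classKernel T g n x ∂(μ : Measure X) = ∫⁻ x, φ x ∂(μ : Measure X) := by
    intro n φ hφ
    have hprob := isProbabilityMeasure_classKernel hT hsurj hg n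
    have hk := measurable_classKernel hT hsurj hgc hg n
    have hbind : (μ : Measure X).bind (classKernel T g n) = μ := by
      refine (ext_of_forall_lintegral_eq_of_IsFiniteMeasure fun f => ?_).symm
      have hf : Continuous fun x => (f x : ℝ) := NNReal.continuous_coe.comp f.continuous
      have hc := continuous_classMean hT hsurj hgc hg n hf
      rw [Measure.lintegral_bind hk.aemeasurable
        f.continuous.measurable.coe_nnreal_ennreal.aemeasurable]
      have e : ∀ x, (f x : ℝ≥0∞) = ENNReal.ofReal (f x : ℝ) := fun x =>
        (ENNReal.ofReal_coe_nnreal).symm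
      have e' : ∀ x, ∫⁻ y, f y ∂classKernel T g n x =
          ENNReal.ofReal (classMean T g n (fun x => (f x : ℝ)) x) := fun x => by
        simp_rw [e]
        rw [← integral_classKernel hT hsurj hg n hf,
          ofReal_integral_eq_lintegral_ofReal (hint _ hf) (.of_forall fun x => (f x).2)]
      have hc0 : ∀ x, 0 ≤ classMean T g n (fun x => (f x : ℝ)) x := fun x => by
        rw [← integral_classKernel hT hsurj hg n hf]
        exact integral_nonneg fun x => (f x).2
      simp_rw [e', e]
      rw [← ofReal_integral_eq_lintegral_ofReal (hint _ hf) (.of_forall fun x => (f x).2),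
        ← ofReal_integral_eq_lintegral_ofReal (hint _ hc) (.of_forall hc0), hμ n _ hf]
    conv_rhs => rw [← hbind]
    rw [Measure.lintegral_bind hk.aemeasurable hφ.aemeasurable]
  have hmain : haarMeasure T (μ : Measure X) =
      (haarMeasureInv T (μ : Measure X)).withDensity
        fun γ => ENNReal.ofReal (stationaryFun T g γ) := by
    refine Measure.ext_of_iUnion_eq_univ iUnion_level fun n => ?_
    have hE := measurableSet_level hT.continuous n
    ext A hA
    have hA1 : Measurable (A.indicator (1 : AsympRel T → ℝ≥0∞)) := measurable_one.indicator hA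
    rw [← lintegral_indicator_one hA, ← lintegral_indicator_one hA,
      setLIntegral_withDensity_eq_setLIntegral_mul _ hD hA1 hE]
    exact setLIntegral_level_eq_of_invariant hT hgc hg n (inv n) hA1
  refine ⟨⟨?_, ?_⟩, hmain⟩
  · rw [hmain]
    exact withDensity_absolutelyContinuous _ _
  · rw [hmain]
    refine withDensity_absolutelyContinuous' hD.aemeasurable (.of_forall fun γ => ?_)
    exact (ENNReal.ofReal_pos.2
      ((stationaryCocycle T hT.continuous g hgc hg).pos γ)).ne'

end Solutions

/-! ### Unique ergodicity -/

theorem AsympRel.IsMinimal.iterate {X : Type*} [TopologicalSpace X] {T : X → X}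
    (hmin : AsympRel.IsMinimal T) {M : ℕ} (hM : 1 ≤ M) : AsympRel.IsMinimal T^[M] := by
  refine fun x => (hmin x).mono ?_
  rintro y ⟨n, hn⟩
  refine ⟨n, ?_⟩
  obtain ⟨k, rfl⟩ := Nat.exists_eq_add_of_le' hM
  rw [← Function.iterate_mul, add_mul, one_mul, Function.iterate_add_apply,
    Function.iterate_add_apply, hn]

theorem mainTheorem4 {X : Type*} [UniformSpace X] [CompactSpace X] [T2Space X] [Nonempty X]
    [MeasurableSpace X] [BorelSpace X]
    (T : X → X) (hT : IsLocalHomeomorph T) (hsurj : Function.Surjective T)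
    (g : X → ℝ) (hgc : Continuous g) (hg : ∀ x, 0 < g x)
    (hmin : AsympRel.IsMinimal T)
    (hgen : ∃ L : ℕ, 1 ≤ L ∧ ∃ 𝒱 𝒰 : Set (Set X), IsGeneratingCover (T^[L]) 𝒱 𝒰)
    (hW : ∃ M : ℕ, 1 ≤ M ∧ WaltersCondition (T^[M]) (orbitProd T g M)) :
    (stationaryCocycle T hT.continuous g hgc hg).UniquelyErgodic := by
  obtain ⟨M, hM, hW⟩ := hW
  have hS := hT.iterate M
  have : (𝓤 X).IsCountablyGenerated := by
    obtain ⟨Δ, hΔ, hd, -⟩ := hW 1 one_pos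
    exact isCountablyGenerated_uniformity_of_expansive hS.continuous hΔ hd.subset
  have hint : ∀ (ν : Measure X) [IsFiniteMeasure ν] {f : X → ℝ}, Continuous f → Integrable f ν :=
    fun ν _ f hf => hf.integrable_of_hasCompactSupport (HasCompactSupport.of_compactSpace f)
  have hprob := isProbabilityMeasure_classKernel hT hsurj hg
  -- along the multiples of `M`, the means of `f` converge uniformly to a constant `A f`
  have hlim : ∀ f : X → ℝ, ∃ A : ℝ, Continuous f → ∀ ε > 0, ∃ n₀, ∀ n ≥ n₀, ∀ x,
      |classMean T g (M * n) f x - A| ≤ ε := by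
    intro f
    by_cases hf : Continuous f
    · obtain ⟨A, hA⟩ := exists_classMean_limit hS (hsurj.iterate M)
        (continuous_orbitProd hT.continuous hgc M) (orbitProd_pos hg M) (hmin.iterate hM) hW hf
      simp only [classMean_iterate] at hA
      exact ⟨A, fun _ => hA⟩
    · exact ⟨0, fun h => absurd h hf⟩
  choose A hA using hlim
  have htend : ∀ f : X → ℝ, Continuous f → ∀ x,
      Filter.Tendsto (fun n => classMean T g (M * n) f x) Filter.atTop (𝓝 (A f)) := by
    intro f hf x
    refine Metric.tendsto_atTop'.2 fun ε hε => ?_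
    obtain ⟨n₀, hn₀⟩ := hA f hf (ε / 2) (half_pos hε)
    exact ⟨n₀, fun n hn => (hn₀ n hn.le x).trans_lt (half_lt_self hε)⟩
  -- an invariant measure integrates `f` to `A f`
  have hval : ∀ μ : ProbabilityMeasure X, IsMeanInvariant T g μ → ∀ f : X → ℝ, Continuous f →
      ∫ x, f x ∂(μ : Measure X) = A f := by
    intro μ hμ f hf
    refine eq_of_abs_sub_nonpos (le_of_forall_pos_le_add fun ε hε => ?_)
    obtain ⟨n₀, hn₀⟩ := hA f hf ε hε
    have h1 := norm_integral_le_of_norm_le_const (μ := (μ : Measure X))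
      (f := fun x => classMean T g (M * n₀) f x - A f) (.of_forall (hn₀ n₀ le_rfl))
    rw [integral_sub (hint _ (continuous_classMean hT hsurj hgc hg _ hf)) (integrable_const _),
      hμ _ f hf] at h1
    simpa using h1
  -- a limit point of the measures `classKernel` is invariant
  obtain ⟨μ, hμ⟩ : ∃ μ : ProbabilityMeasure X, IsMeanInvariant T g μ := by
    let x₀ : X := Classical.arbitrary X
    let ν : ℕ → ProbabilityMeasure X := fun n => ⟨classKernel T g (M * n) x₀, hprob _ _⟩
    let 𝔘 : Ultrafilter ℕ := Ultrafilter.of Filter.atTop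
    obtain ⟨μ, hμ⟩ : ∃ μ, Filter.Tendsto ν 𝔘 (𝓝 μ) := by
      obtain ⟨μ, -, hμ⟩ := isCompact_univ.ultrafilter_le_nhds (𝔘.map ν) (by simp)
      exact ⟨μ, hμ⟩
    have hμA : ∀ f : X → ℝ, Continuous f → ∫ x, f x ∂(μ : Measure X) = A f := by
      intro f hf
      have h1 := ProbabilityMeasure.tendsto_iff_forall_integral_tendsto.1 hμ
        (BoundedContinuousFunction.mkOfCompact ⟨f, hf⟩)
      refine tendsto_nhds_unique h1 ?_
      refine ((htend f hf x₀).mono_left (Ultrafilter.of_le _)).congr fun n => ?_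
      exact (integral_classKernel hT hsurj hg (M * n) hf x₀).symm
    refine ⟨μ, fun n f hf => ?_⟩
    have hc := continuous_classMean hT hsurj hgc hg n hf
    rw [hμA f hf, hμA _ hc]
    refine tendsto_nhds_unique (htend _ hc x₀) ((htend f hf x₀).congr' ?_)
    filter_upwards [Filter.eventually_ge_atTop n] with k hk
    rw [classMean_classMean hT hsurj hg (hk.trans (Nat.le_mul_of_pos_left k hM))]
  refine ⟨μ, eq_singleton_iff_unique_mem.2
    ⟨solution_of_isMeanInvariant hT hsurj hgc hg hμ, fun μ' hμ' => ?_⟩⟩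
  have hμ'' := isMeanInvariant_of_solution hT hsurj hgc hg hμ'
  refine Subtype.ext (ext_of_forall_integral_eq_of_IsFiniteMeasure
    (μ := (μ' : Measure X)) (ν := (μ : Measure X)) fun f => ?_)
  exact (hval μ' hμ'' f f.continuous).trans (hval μ hμ f f.continuous).symm
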